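/- Let $S^1=\{z\in\mathbb C:|z|=1\}$ and let $\mathcal H(S^1)$ be the ring of functions holomorphic on (a neighbourhood of) $S^1$, two functions being identified if they agree on a neighbourhood of $S^1$. For $A(z)=[a_{i,j}(z)]\in\mathcal H(S^1)^{n\times n}$ the para-Hermitian conjugate $A(z)^P\in\mathcal H(S^1)^{n\times n}$ is the matrix whose $(i,j)$ entry is $\overline{a_{j,i}(\overline z^{\,-1})}$; $A(z)$ is called para-Hermitian if $A(z)=A(z)^P$, and $U(z)\in\mathcal H(S^1)^{n\times n}$ is called para-unitary if $U(z)U(z)^P=U(z)^PU(z)=I$. Theorem. Let $A(z)\in\mathcal H(S^1)^{n\times n}$ be para-Hermitian, and let $\mu_1(z),\dots,\mu_n(z)\in\mathcal H(S^1)$ be such that, for every $z_0\in S^1$, the eigenvalues of $A(z_0)$, counted with algebraic multiplicity, are precisely $\mu_1(z_0),\dots,\mu_n(z_0)$. Then there exists a para-unitary matrix $U(z)\in\mathcal H(S^1)^{n\times n}$ such that $$A(z)=U(z)\,D(z)\,U(z)^P,\qquad D(z)=\operatorname{diag}(\mu_1(z),\dots,\mu_n(z)).$$ -/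

import Mathlib

open scoped Topology

/-- The unit circle `S¹ = {z : |z| = 1}` in the complex plane. -/
def unitCircle : Set ℂ := Metric.sphere (0 : ℂ) 1

/-- A function `f` represents an element of `H(S¹)`: it is holomorphic on the unit circle, that is,
complex analytic at every point of `S¹`, hence holomorphic on an open neighbourhood of `S¹`. Values
of `f` away from `S¹` are irrelevant, and two such functions are the same element of `H(S¹)` when
they agree on a neighbourhood of `S¹` (`=ᶠ[𝓝ˢ unitCircle]`). -/
def HolomorphicOnCircle (f : ℂ → ℂ) : Prop := AnalyticOnNhd ℂ f unitCircle

/-- `A(z) ∈ H(S¹)^{m × n}`: every entry of the matrix function is holomorphic on the circle. -/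
def MatrixHolomorphicOnCircle {m n : ℕ} (A : ℂ → Matrix (Fin m) (Fin n) ℂ) : Prop :=
  ∀ i j, HolomorphicOnCircle (fun z => A z i j)

/-- The para-Hermitian conjugate `A(z)^P`, whose `(i, j)` entry at `z` is the complex conjugate of
`a_{j,i}` at the point `(conj z)⁻¹`. -/
noncomputable def paraConj {m n : ℕ} (A : ℂ → Matrix (Fin m) (Fin n) ℂ) :
    ℂ → Matrix (Fin n) (Fin m) ℂ :=
  fun z => Matrix.of fun i j => starRingEnd ℂ (A ((starRingEnd ℂ z)⁻¹) j i)

/-- `A(z) ∈ H(S¹)^{n × n}` is para-Hermitian if `A(z) = A(z)^P` (near `S¹`). -/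
structure IsParaHermitian {n : ℕ} (A : ℂ → Matrix (Fin n) (Fin n) ℂ) : Prop where
  holomorphic : MatrixHolomorphicOnCircle A
  eq_paraConj : ∀ᶠ z in 𝓝ˢ unitCircle, A z = paraConj A z

/-- `U(z) ∈ H(S¹)^{n × n}` is para-unitary if `U(z) U(z)^P = U(z)^P U(z) = I` (near `S¹`). -/
structure IsParaUnitary {n : ℕ} (U : ℂ → Matrix (Fin n) (Fin n) ℂ) : Prop where
  holomorphic : MatrixHolomorphicOnCircle U
  mul_paraConj : ∀ᶠ z in 𝓝ˢ unitCircle, U z * paraConj U z = 1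
  paraConj_mul : ∀ᶠ z in 𝓝ˢ unitCircle, paraConj U z * U z = 1

/-!
By the identity principle an element of `H(S¹)` is determined by its restriction to `S¹`, and there
the para-Hermitian conjugate is the pointwise conjugate transpose. Hence `H(S¹)` may be regarded as
a commutative ring `circleHolomorphic` of functions on `S¹`, an integral domain with complex
conjugation as its involution, and the claim becomes the spectral theorem for a Hermitian matrix
over this ring whose characteristic polynomial splits.

The property of the ring that makes the spectral theorem work is that every nonzero vector is a
scalar multiple of a unit vector (`circleHolomorphic.exists_eq_smul_unit`). Indeed, the common zeros
of its components on `S¹` are finite in number and can be divided out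
(`exists_eq_mul_nonvanishing`); the squared norm is then positive on `S¹`, so it has an inverse
square root in the ring (`circleHolomorphic.exists_inv_sqrt`).

Over such a ring the usual induction applies (`exists_unitary_diagonalization`). A root of the
characteristic polynomial has an eigenvector because the ring is a domain, and it may be taken to be
a unit vector. A Gram-Schmidt argument (`exists_isometry_first_column`) completes it to a unitary
matrix. Conjugation by that matrix splits off a block of size one, and the characteristic polynomial
of the remaining block is the product of the remaining linear factors.
-/

/-! ### Diagonalization over a domain in which vectors can be normalized -/

section Diagonalization

open Matrix Polynomial

/-- Fewer than `n` linear conditions on `R ^ n` have a nonzero common solution (the strong rank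
condition), which `hR` normalizes. -/
theorem exists_orthogonal_unit_of_lt {R : Type*} [CommRing R] [IsDomain R] [StarRing R]
    (hR : ∀ (n : ℕ) (v : Fin n → R), v ≠ 0 → ∃ (c : R) (u : Fin n → R), v = c • u ∧ star u ⬝ᵥ u = 1)
    {n k : ℕ} (hk : k < n) (W : Matrix (Fin n) (Fin k) R) :
    ∃ u : Fin n → R, star u ⬝ᵥ u = 1 ∧ Wᴴ *ᵥ u = 0 := by
  have hinj : ¬ Function.Injective (Wᴴ).mulVecLin := fun h =>
    absurd (le_of_fin_injective R _ h) (by omega)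
  rw [injective_iff_map_eq_zero] at hinj
  push Not at hinj
  obtain ⟨v, hv, hv0⟩ := hinj
  obtain ⟨c, u, rfl, hu⟩ := hR n v hv0
  refine ⟨u, hu, ?_⟩
  have hc : c ≠ 0 := by rintro rfl; simp at hv0
  rw [mulVecLin_apply, mulVec_smul] at hv
  exact (smul_eq_zero.mp hv).resolve_left hc

/-- Gram-Schmidt: a unit vector is the first column of a matrix with orthonormal columns. For
`k + 1 = n` this matrix is unitary. -/
theorem exists_isometry_first_column {R : Type*} [CommRing R] [IsDomain R] [StarRing R]
    (hR : ∀ (n : ℕ) (v : Fin n → R), v ≠ 0 → ∃ (c : R) (u : Fin n → R), v = c • u ∧ star u ⬝ᵥ u = 1)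
    {n : ℕ} (u : Fin n → R) (hu : star u ⬝ᵥ u = 1) (k : ℕ) (hk : k + 1 ≤ n) :
    ∃ W : Matrix (Fin n) (Fin (k + 1)) R, Wᴴ * W = 1 ∧ W.col 0 = u := by
  induction k with
  | zero =>
    refine ⟨of fun i _ => u i, ?_, rfl⟩
    ext i j
    obtain rfl : i = 0 := Subsingleton.elim (α := Fin 1) _ _
    obtain rfl : j = 0 := Subsingleton.elim (α := Fin 1) _ _
    simpa [mul_apply, dotProduct] using hu
  | succ k ih =>
    obtain ⟨W, hW, hW0⟩ := ih (by omega)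
    obtain ⟨v, hv, hWv⟩ := exists_orthogonal_unit_of_lt hR (by omega) W
    have hW' : ∀ i j, ∑ x, star (W x i) * W x j = (1 : Matrix _ _ R) i j := fun i j => by
      simpa [mul_apply] using congrFun (congrFun hW i) j
    have hv' : ∀ i, ∑ x, star (W x i) * v x = 0 := fun i => by
      simpa [mulVec, dotProduct] using congrFun hWv i
    have hv'' : ∀ i, ∑ x, star (v x) * W x i = 0 := fun i => by
      simpa [mul_comm] using congrArg star (hv' i)
    refine ⟨of fun i => Fin.snoc (W i) (v i), ?_, ?_⟩
    · ext i j
      refine Fin.lastCases ?_ (fun i => ?_) i <;> refine Fin.lastCases ?_ (fun j => ?_) j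
      · simpa [mul_apply, dotProduct] using hv
      · simpa [mul_apply, one_apply, (Fin.castSucc_lt_last j).ne'] using hv'' j
      · simpa [mul_apply, one_apply, (Fin.castSucc_lt_last i).ne] using hv' i
      · simpa [mul_apply, one_apply] using hW' i j
    · rw [← hW0]
      ext i
      simp only [col_apply, of_apply]
      rw [← Fin.castSucc_zero, Fin.snoc_castSucc]

theorem charpoly_eq_of_first_column {R : Type*} [CommRing R] {n : ℕ}
    (M : Matrix (Fin (n + 1)) (Fin (n + 1)) R) (hM : ∀ i : Fin n, M i.succ 0 = 0) :
    M.charpoly = (X - C (M 0 0)) * (M.submatrix Fin.succ Fin.succ).charpoly := by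
  rw [charpoly, det_succ_column_zero, Fin.sum_univ_succ]
  have h : (M.charmatrix.submatrix Fin.succ Fin.succ) =
      (M.submatrix Fin.succ Fin.succ).charmatrix := by
    ext i j : 2
    by_cases hij : i = j
    · subst hij; simp
    · simp [charmatrix_apply_ne, hij]
  simp [charmatrix_apply_ne, hM, h, charpoly]

/-- The spectral theorem over a domain with involution in which every nonzero vector is a multiple
of a unit vector (hypothesis `hR`), for Hermitian matrices with split characteristic polynomial. -/
theorem exists_unitary_diagonalization {R : Type*} [CommRing R] [IsDomain R] [StarRing R]
    (hR : ∀ (n : ℕ) (v : Fin n → R), v ≠ 0 → ∃ (c : R) (u : Fin n → R), v = c • u ∧ star u ⬝ᵥ u = 1)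
    (n : ℕ) (A : Matrix (Fin n) (Fin n) R) (hA : A.IsHermitian) (μ : Fin n → R)
    (hμ : A.charpoly = ∏ i, (X - C (μ i))) :
    ∃ U : Matrix (Fin n) (Fin n) R, Uᴴ * U = 1 ∧ A * U = U * diagonal μ := by
  induction n with
  | zero => exact ⟨1, Subsingleton.elim _ _, Subsingleton.elim _ _⟩
  | succ n ih =>
    have hdet : (A - scalar _ (μ 0)).det = 0 := by
      have : A.charpoly.eval (μ 0) = 0 := by
        rw [hμ, eval_prod]
        exact Finset.prod_eq_zero (Finset.mem_univ 0) (by simp)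
      rw [eval_charpoly] at this
      rw [← neg_sub, det_neg, this, mul_zero]
    obtain ⟨v, hv0, hv⟩ := exists_mulVec_eq_zero_iff.mpr hdet
    obtain ⟨c, u, rfl, hu⟩ := hR _ v hv0
    have hc : c ≠ 0 := by rintro rfl; simp at hv0
    have hAu : A *ᵥ u = μ 0 • u := by
      rw [mulVec_smul] at hv
      have := (smul_eq_zero.mp hv).resolve_left hc
      rw [sub_mulVec, sub_eq_zero] at this
      simpa [← smul_one_eq_diagonal, smul_mulVec] using this
    obtain ⟨Q, hQ, hQ0⟩ := exists_isometry_first_column hR u hu n le_rfl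
    have hQ' : Q * Qᴴ = 1 := mul_eq_one_comm.mp hQ
    set B := Qᴴ * A * Q with hB
    have hBH : B.IsHermitian := isHermitian_conjTranspose_mul_mul Q hA
    have hcol : ∀ i, B i 0 = (if i = 0 then μ 0 else 0) := fun i => by
      have h1 : B.col 0 = μ 0 • (Qᴴ * Q).col 0 := by
        have hcolmul : ∀ (M : Matrix (Fin (n+1)) (Fin (n+1)) R), (M * Q).col 0 = M *ᵥ u := by
          intro M; rw [← hQ0]; rfl
        rw [hB, hcolmul, hcolmul, ← mulVec_mulVec, hAu, mulVec_smul]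
      -- `B e₀ = μ 0 • e₀`, because `Q e₀ = u` is an eigenvector
      have := congrFun h1 i
      rw [hQ] at this
      simpa [one_apply] using this
    have hrow : ∀ j : Fin n, B 0 j.succ = 0 := fun j => by
      rw [← hBH.apply, hcol]; simp
    have hchar : (B.submatrix Fin.succ Fin.succ).charpoly = ∏ i : Fin n, (X - C (μ i.succ)) := by
      have h1 : B.charpoly = A.charpoly := by
        rw [hB, charpoly_mul_comm, ← Matrix.mul_assoc, hQ', Matrix.one_mul]
      rw [charpoly_eq_of_first_column B (fun i => by rw [hcol]; simp), hμ, Fin.prod_univ_succ,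
        hcol, if_pos rfl] at h1
      exact mul_left_cancel₀ (X_sub_C_ne_zero _) h1
    obtain ⟨V, hV, hAV⟩ := ih _ (hBH.submatrix _) _ hchar
    -- the block-diagonal matrix with blocks `1` and `V`
    set V' : Matrix (Fin (n + 1)) (Fin (n + 1)) R :=
      of (Fin.cons (Fin.cons 1 0) fun i => Fin.cons 0 (V i)) with hV'
    have hV'V : V'ᴴ * V' = 1 := by
      ext i j
      refine Fin.cases ?_ (fun i => ?_) i <;> refine Fin.cases ?_ (fun j => ?_) j
      · simp [mul_apply, Fin.sum_univ_succ, hV']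
      · simp [mul_apply, Fin.sum_univ_succ, hV', one_apply, (Fin.succ_ne_zero j).symm]
      · simp [mul_apply, Fin.sum_univ_succ, hV', one_apply]
      · simpa [mul_apply, Fin.sum_univ_succ, hV', one_apply] using congrFun (congrFun hV i) j
    have hBV : B * V' = V' * diagonal μ := by
      ext i j
      refine Fin.cases ?_ (fun i => ?_) i <;> refine Fin.cases ?_ (fun j => ?_) j
      · simp [mul_apply, Fin.sum_univ_succ, hV', hcol, diagonal_apply]
      · simp [mul_apply, Fin.sum_univ_succ, hV', hrow, diagonal_apply]
      · simp [mul_apply, Fin.sum_univ_succ, hV', hcol, diagonal_apply]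
      · have := congrFun (congrFun hAV i) j
        simp only [mul_diagonal] at this
        rw [mul_diagonal]
        simpa [mul_apply, Fin.sum_univ_succ, hV', hcol] using this
    refine ⟨Q * V', ?_, ?_⟩
    · rw [conjTranspose_mul, Matrix.mul_assoc, ← Matrix.mul_assoc Qᴴ, hQ, Matrix.one_mul, hV'V]
    · rw [Matrix.mul_assoc, ← hBV, hB, ← Matrix.mul_assoc Q, ← Matrix.mul_assoc Q,
        ← Matrix.mul_assoc Q, hQ', Matrix.one_mul, Matrix.mul_assoc]

end Diagonalization

section Circle

open Filter Set

/-! ### Functions holomorphic on the unit circle -/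

theorem isPreconnected_unitCircle : IsPreconnected unitCircle :=
  isPreconnected_sphere (by simp) _ _

theorem isCompact_unitCircle : IsCompact unitCircle := isCompact_sphere _ _

theorem nontrivial_unitCircle : unitCircle.Nontrivial :=
  ⟨1, by simp [unitCircle], -1, by simp [unitCircle], by norm_num⟩

theorem ne_zero_of_mem_unitCircle {z : ℂ} (hz : z ∈ unitCircle) : z ≠ 0 := by
  rintro rfl
  simp [unitCircle] at hz

theorem conj_inv_of_mem_unitCircle {z : ℂ} (hz : z ∈ unitCircle) :
    (starRingEnd ℂ z)⁻¹ = z := by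
  have h : ‖z‖ = 1 := by simpa [unitCircle] using hz
  rw [← Complex.inv_eq_conj h, inv_inv]

/-- The identity principle: an element of `H(S¹)` is determined by its values on `S¹`. -/
theorem HolomorphicOnCircle.eventuallyEq {f g : ℂ → ℂ} (hf : HolomorphicOnCircle f)
    (hg : HolomorphicOnCircle g) (h : EqOn f g unitCircle) : f =ᶠ[𝓝ˢ unitCircle] g := by
  rw [EventuallyEq, eventually_nhdsSet_iff_forall]
  intro z hz
  rw [← (hf z hz).frequently_eq_iff_eventually_eq (hg z hz)]
  have : ∃ᶠ w in 𝓝[≠] z, w ∈ unitCircle := frequently_mem_iff_neBot.mpr <|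
    isPreconnected_unitCircle.preperfect_of_nontrivial nontrivial_unitCircle z hz
  exact this.mono fun w hw => h hw

/-- The para-Hermitian conjugate of a scalar function is holomorphic on the circle. -/
theorem HolomorphicOnCircle.star_conj_inv {f : ℂ → ℂ} (hf : HolomorphicOnCircle f) :
    HolomorphicOnCircle fun z => starRingEnd ℂ (f (starRingEnd ℂ z)⁻¹) := by
  intro z hz
  have hg : AnalyticAt ℂ (fun w => starRingEnd ℂ (f (starRingEnd ℂ w))) z⁻¹ := by
    have hz' : starRingEnd ℂ z⁻¹ ∈ unitCircle := by
      rwa [map_inv₀, conj_inv_of_mem_unitCircle hz]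
    rw [Complex.analyticAt_iff_eventually_differentiableAt]
    have h := (hf _ hz').eventually_analyticAt
    have := (Complex.continuous_conj.tendsto z⁻¹).eventually h
    filter_upwards [this] with w hw
    simpa [Function.comp_def] using hw.differentiableAt.conj_conj
  have := AnalyticAt.fun_comp hg (analyticAt_inv (ne_zero_of_mem_unitCircle hz))
  simpa [Function.comp_def] using this

theorem HolomorphicOnCircle.dslope {f : ℂ → ℂ} (hf : HolomorphicOnCircle f) {a : ℂ} :
    HolomorphicOnCircle (dslope f a) := by
  intro z hz
  rcases eq_or_ne z a with rfl | hza
  · obtain ⟨p, hp⟩ := hf z hz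
    exact ⟨_, hp.has_fpower_series_dslope_fslope⟩
  · refine AnalyticAt.congr ?_ (dslope_eventuallyEq_slope_of_ne f hza).symm
    have : slope f a = fun w => (w - a)⁻¹ * (f w - f a) := by
      ext w; simp [slope_def_field, div_eq_inv_mul]
    rw [this]
    exact ((analyticAt_id.sub analyticAt_const).inv (sub_ne_zero.mpr hza)).mul
      ((hf z hz).sub analyticAt_const)

theorem HolomorphicOnCircle.finite_zeros {f : ℂ → ℂ} (hf : HolomorphicOnCircle f)
    (h : ¬ EqOn f 0 unitCircle) : {z ∈ unitCircle | f z = 0}.Finite := by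
  have := (hf.eqOn_zero_or_eventually_ne_zero_of_preconnected
    isPreconnected_unitCircle).resolve_left h
  refine (isCompact_unitCircle.finite_sdiff_of_mem_codiscreteWithin this).subset ?_
  rintro z ⟨hz, hfz⟩
  exact ⟨hz, by simpa using hfz⟩

theorem HolomorphicOnCircle.analyticOrderAt_ne_top {f : ℂ → ℂ} (hf : HolomorphicOnCircle f)
    (h : ¬ EqOn f 0 unitCircle) {z : ℂ} (hz : z ∈ unitCircle) : analyticOrderAt f z ≠ ⊤ := by
  intro htop
  exact h (hf.eqOn_zero_of_preconnected_of_eventuallyEq_zero isPreconnected_unitCircle hz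
    (analyticOrderAt_eq_top.mp htop))

/-- A vector of functions holomorphic on the circle, not identically zero there, is a scalar
multiple of one without zeros on the circle: the common zeros are divided out one at a time, and
the total order of vanishing of a fixed nonzero component decreases. -/
theorem exists_eq_mul_nonvanishing {n : ℕ} (v : Fin n → ℂ → ℂ)
    (hv : ∀ i, HolomorphicOnCircle (v i)) (j : Fin n) (hj : ¬ EqOn (v j) 0 unitCircle) :
    ∃ (c : ℂ → ℂ) (w : Fin n → ℂ → ℂ), HolomorphicOnCircle c ∧ (∀ i, HolomorphicOnCircle (w i)) ∧
      (∀ i, ∀ z ∈ unitCircle, v i z = c z * w i z) ∧ ∀ z ∈ unitCircle, ∃ i, w i z ≠ 0 := by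
  -- `S` stays fixed in the induction: the quotients vanish only at zeros of the original `v j`
  obtain ⟨S, hS⟩ : ∃ S : Finset ℂ, (S : Set ℂ) = {z ∈ unitCircle | v j z = 0} :=
    ⟨((hv j).finite_zeros hj).toFinset, by simp⟩
  have hSc : ∀ z ∈ S, z ∈ unitCircle := fun z hz => (hS.subset hz).1
  replace hS : ∀ z ∈ unitCircle, v j z = 0 → z ∈ S := fun z hz h => hS.superset ⟨hz, h⟩
  obtain ⟨N, hN⟩ : ∃ N, ∑ z ∈ S, analyticOrderNatAt (v j) z < N := ⟨_, Nat.lt_succ_self _⟩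
  induction N generalizing v with
  | zero => simp at hN
  | succ N ih =>
    by_cases hz : ∀ z ∈ unitCircle, ∃ i, v i z ≠ 0
    · exact ⟨fun _ => 1, v, analyticOnNhd_const, hv, by simp, hz⟩
    push Not at hz
    obtain ⟨a, ha, hva⟩ := hz
    have hdiv : ∀ i z, v i z = (z - a) * dslope (v i) a z := fun i z => by
      have := sub_smul_dslope (v i) a z
      rw [hva, sub_zero, smul_eq_mul] at this
      exact this.symm
    have hg : ¬ EqOn (dslope (v j) a) 0 unitCircle := fun h => hj fun z hz => by
      rw [hdiv, h hz]; simp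
    have hmul : ∀ z ∈ unitCircle, analyticOrderNatAt (v j) z =
        analyticOrderNatAt (fun w => w - a) z + analyticOrderNatAt (dslope (v j) a) z := by
      intro z hz
      have hne : ¬ EqOn (fun w => w - a) 0 unitCircle := fun h => hj fun z hz => by
        rw [hdiv]; simp [show z - a = 0 from h hz]
      have hlin : HolomorphicOnCircle (fun w => w - a) := fun z _ =>
        analyticAt_id.sub analyticAt_const
      rw [← analyticOrderNatAt_mul (hlin z hz) ((hv j).dslope z hz)
        (hlin.analyticOrderAt_ne_top hne hz) ((hv j).dslope.analyticOrderAt_ne_top hg hz)]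
      congr 1
      exact funext fun w => hdiv j w
    have hlt : ∑ z ∈ S, analyticOrderNatAt (dslope (v j) a) z <
        ∑ z ∈ S, analyticOrderNatAt (v j) z := by
      refine Finset.sum_lt_sum (fun z hz => ?_) ⟨a, hS a ha (hva j), ?_⟩
      · rw [hmul z (hSc z hz)]; exact Nat.le_add_left _ _
      · have h1 : analyticOrderNatAt (fun w : ℂ => w - a) a = 1 := by
          have : analyticOrderAt (fun w : ℂ => w - a) a = 1 := by
            exact analyticOrderAt_id_sub_const_self (𝕜 := ℂ) (c := a)
          simp [analyticOrderNatAt, this]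
        rw [hmul a ha, h1]; omega
    obtain ⟨c, w, hc, hw, hcw, hne⟩ := ih (fun i => dslope (v i) a) (fun i => (hv i).dslope) hg
      (fun z hz h => hS z hz (by rw [hdiv, h, mul_zero])) (by omega)
    refine ⟨fun z => (z - a) * c z, w, fun z hz => ?_, hw, fun i z hz => ?_, hne⟩
    · exact (analyticAt_id.sub analyticAt_const).mul (hc z hz)
    · rw [hdiv, hcw i z hz, mul_assoc]

/-! ### The ring `H(S¹)` -/

/-- The ring `H(S¹)`, realised as the ring of restrictions to `S¹` of functions holomorphic on `S¹`;
by the identity principle nothing is lost in restricting. Its involution is pointwise complex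
conjugation on `S¹`, so that the para-Hermitian conjugate becomes the conjugate transpose. -/
noncomputable def circleHolomorphic : StarSubalgebra ℂ (unitCircle → ℂ) where
  carrier := {f | ∃ F : ℂ → ℂ, HolomorphicOnCircle F ∧ ∀ z : unitCircle, f z = F z}
  mul_mem' := by
    rintro f g ⟨F, hF, hf⟩ ⟨G, hG, hg⟩
    exact ⟨fun z => F z * G z, hF.mul hG, fun z => by simp [hf, hg]⟩
  add_mem' := by
    rintro f g ⟨F, hF, hf⟩ ⟨G, hG, hg⟩
    exact ⟨fun z => F z + G z, hF.add hG, fun z => by simp [hf, hg]⟩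
  algebraMap_mem' c := ⟨fun _ => c, analyticOnNhd_const, fun z => by simp⟩
  star_mem' := by
    rintro f ⟨F, hF, hf⟩
    exact ⟨_, hF.star_conj_inv, fun z => by
      simp [hf, conj_inv_of_mem_unitCircle z.2]⟩

namespace circleHolomorphic

/-- The element of the ring `H(S¹)` given by a function holomorphic on the circle. -/
noncomputable def mk (f : ℂ → ℂ) (hf : HolomorphicOnCircle f) : circleHolomorphic :=
  ⟨fun z => f z, f, hf, fun _ => rfl⟩

/-- Evaluation at a point of the circle. -/
noncomputable def eval (z : unitCircle) : circleHolomorphic →+* ℂ :=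
  (Pi.evalRingHom (fun _ : unitCircle => ℂ) z).comp circleHolomorphic.subtype.toRingHom

@[simp] theorem eval_mk (f : ℂ → ℂ) (hf : HolomorphicOnCircle f) (z : unitCircle) :
    eval z (mk f hf) = f z := rfl

@[simp] theorem eval_star (f : circleHolomorphic) (z : unitCircle) :
    eval z (star f) = star (eval z f) := rfl

theorem ext_eval {f g : circleHolomorphic} (h : ∀ z, eval z f = eval z g) : f = g :=
  Subtype.ext (funext h)

theorem exists_mk_eq (f : circleHolomorphic) : ∃ F, ∃ hF : HolomorphicOnCircle F, mk F hF = f := by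
  obtain ⟨f, F, hF, h⟩ := f
  exact ⟨F, hF, ext_eval fun z => (h z).symm⟩

instance : Nontrivial circleHolomorphic :=
  ⟨0, 1, fun h => by
    simpa using congrArg (eval ⟨1, by simp [unitCircle]⟩) h⟩

instance : NoZeroDivisors circleHolomorphic where
  eq_zero_or_eq_zero_of_mul_eq_zero {f g} h := by
    obtain ⟨F, hF, rfl⟩ := exists_mk_eq f
    obtain ⟨G, hG, rfl⟩ := exists_mk_eq g
    refine (hF.eq_zero_or_eq_zero_of_mul_eq_zero hG (fun z hz => ?_)
      isPreconnected_unitCircle).imp (fun h => ?_) fun h => ?_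
    · simpa using congrArg (eval ⟨z, hz⟩) h
    all_goals exact ext_eval fun z => by simpa using h z z.2

instance : IsDomain circleHolomorphic := NoZeroDivisors.to_isDomain _

/-- The inverse square root of a positive function is again in `H(S¹)`: near the circle such a
function takes values in the slit plane, where the principal power is holomorphic. -/
theorem exists_inv_sqrt (q : circleHolomorphic) (hq : ∀ z, ∃ r : ℝ, 0 < r ∧ eval z q = r) :
    ∃ t : circleHolomorphic, star t = t ∧ t * t * q = 1 := by
  obtain ⟨Q, hQ, rfl⟩ := exists_mk_eq q
  have ht : HolomorphicOnCircle fun z => Q z ^ ((-(1 / 2) : ℝ) : ℂ) := fun z hz => by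
    obtain ⟨r, hr, h⟩ := hq ⟨z, hz⟩
    refine (hQ z hz).cpow analyticAt_const ?_
    rw [eval_mk] at h
    rw [h]
    exact Complex.ofReal_mem_slitPlane.mpr hr
  refine ⟨mk _ ht, ext_eval fun z => ?_, ext_eval fun z => ?_⟩ <;>
    obtain ⟨r, hr, h⟩ := hq z <;> rw [eval_mk] at h
  · rw [eval_star, eval_mk, h, ← Complex.ofReal_cpow hr.le]
    exact Complex.conj_ofReal _
  · rw [map_mul, map_mul, eval_mk, eval_mk, h, ← Complex.ofReal_cpow hr.le, map_one]
    norm_cast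
    rw [← Real.rpow_add hr]
    norm_num
    rw [Real.rpow_neg_one, inv_mul_cancel₀ hr.ne']

open Matrix in
/-- Every nonzero vector over `H(S¹)` is a scalar multiple of a unit vector. -/
theorem exists_eq_smul_unit (n : ℕ) (v : Fin n → circleHolomorphic) (hv : v ≠ 0) :
    ∃ (c : circleHolomorphic) (u : Fin n → circleHolomorphic), v = c • u ∧ star u ⬝ᵥ u = 1 := by
  choose V hV hVv using fun i => exists_mk_eq (v i)
  obtain ⟨j, hj⟩ := Function.ne_iff.mp hv
  obtain ⟨c, w, hc, hw, hcw, hne⟩ := exists_eq_mul_nonvanishing V hV j fun h => hj <| by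
    rw [← hVv j]
    exact ext_eval fun z => by simpa using h z.2
  set W : Fin n → circleHolomorphic := fun i => mk (w i) (hw i) with hW
  obtain ⟨t, ht, htq⟩ := exists_inv_sqrt (star W ⬝ᵥ W) fun z => by
    obtain ⟨i, hi⟩ := hne z z.2
    refine ⟨∑ i, ‖w i z‖ ^ 2, ?_, ?_⟩
    · exact Finset.sum_pos' (fun _ _ => by positivity) ⟨i, Finset.mem_univ _, by positivity⟩
    · simp [dotProduct, hW, Complex.conj_mul']
  -- `t * q` is the square root of `q = star W ⬝ᵥ W`, so `(t * q) • (t • W) = W`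
  refine ⟨mk c hc * t * (star W ⬝ᵥ W), t • W, ?_, ?_⟩
  · have hvW : v = mk c hc • W := funext fun i => by
      rw [← hVv i]
      exact ext_eval fun z => by simpa [hW] using hcw i z z.2
    rw [smul_smul, hvW]
    congr 1
    linear_combination (-mk c hc) * htq
  · rw [star_smul, ht, smul_dotProduct, dotProduct_smul, smul_eq_mul, smul_eq_mul, ← mul_assoc, htq]

end circleHolomorphic

/-! ### Matrices of functions holomorphic on the circle -/

theorem MatrixHolomorphicOnCircle.mul {l m n : ℕ} {A : ℂ → Matrix (Fin l) (Fin m) ℂ}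
    {B : ℂ → Matrix (Fin m) (Fin n) ℂ} (hA : MatrixHolomorphicOnCircle A)
    (hB : MatrixHolomorphicOnCircle B) : MatrixHolomorphicOnCircle fun z => A z * B z := by
  intro i j z hz
  simp only [Matrix.mul_apply]
  exact Finset.analyticAt_fun_sum _ fun k _ => (hA i k z hz).mul (hB k j z hz)

theorem MatrixHolomorphicOnCircle.paraConj {m n : ℕ} {A : ℂ → Matrix (Fin m) (Fin n) ℂ}
    (hA : MatrixHolomorphicOnCircle A) : MatrixHolomorphicOnCircle (paraConj A) :=
  fun i j => (hA j i).star_conj_inv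

theorem MatrixHolomorphicOnCircle.eventually_eq {m n : ℕ} {A B : ℂ → Matrix (Fin m) (Fin n) ℂ}
    (hA : MatrixHolomorphicOnCircle A) (hB : MatrixHolomorphicOnCircle B)
    (h : ∀ z ∈ unitCircle, A z = B z) : ∀ᶠ z in 𝓝ˢ unitCircle, A z = B z := by
  have : ∀ᶠ z in 𝓝ˢ unitCircle, ∀ i j, A z i j = B z i j :=
    eventually_all.mpr fun i => eventually_all.mpr fun j =>
      (hA i j).eventuallyEq (hB i j) fun z hz => by simp only [h z hz]
  exact this.mono fun z hz => Matrix.ext hz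

theorem paraConj_eq_conjTranspose {m n : ℕ} (A : ℂ → Matrix (Fin m) (Fin n) ℂ) {z : ℂ}
    (hz : z ∈ unitCircle) : paraConj A z = (A z).conjTranspose := by
  ext i j
  simp [paraConj, conj_inv_of_mem_unitCircle hz]

end Circle

open Matrix Polynomial circleHolomorphic in
theorem theorem3p3 (n : ℕ) (A : ℂ → Matrix (Fin n) (Fin n) ℂ) (hA : IsParaHermitian A)
    (μ : Fin n → ℂ → ℂ) (hμ : ∀ i, HolomorphicOnCircle (μ i))
    (heig : ∀ z₀ ∈ unitCircle,
      (A z₀).charpoly.roots = (Finset.univ : Finset (Fin n)).val.map (fun i => μ i z₀)) :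
    ∃ U : ℂ → Matrix (Fin n) (Fin n) ℂ, IsParaUnitary U ∧
      ∀ᶠ z in 𝓝ˢ unitCircle,
        A z = U z * Matrix.diagonal (fun i => μ i z) * paraConj U z := by
  set A' : Matrix (Fin n) (Fin n) circleHolomorphic := of fun i j => mk _ (hA.holomorphic i j)
    with hA'
  set μ' : Fin n → circleHolomorphic := fun i => mk _ (hμ i) with hμ'
  have hmap : ∀ z : unitCircle, A'.map (eval z) = A z := fun z => rfl
  have hherm : A'.IsHermitian := by
    ext i j : 1
    refine ext_eval fun z => ?_
    have := hA.eq_paraConj.self_of_nhdsSet z z.2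
    rw [paraConj_eq_conjTranspose A z.2] at this
    exact (congrFun (congrFun this i) j).symm
  have hchar : A'.charpoly = ∏ i, (X - C (μ' i)) := by
    have h : ∀ z : unitCircle,
        A'.charpoly.map (eval z) = (∏ i, (X - C (μ' i))).map (eval z) := fun z => by
      rw [← charpoly_map, hmap, (IsAlgClosed.splits (A z).charpoly).eq_prod_roots_of_monic
        (charpoly_monic _), heig z z.2, Polynomial.map_prod]
      simp [hμ', Finset.prod, Function.comp_def]
    ext k : 1
    exact ext_eval fun z => by simpa using congrArg (fun p => p.coeff k) (h z)
  obtain ⟨U', hU, hAU⟩ := exists_unitary_diagonalization exists_eq_smul_unit n A' hherm μ' hchar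
  choose F hF hFU using fun i j => exists_mk_eq (U' i j)
  set U : ℂ → Matrix (Fin n) (Fin n) ℂ := fun z => of fun i j => F i j z with hUdef
  have hUhol : MatrixHolomorphicOnCircle U := hF
  have hUmap : ∀ z : unitCircle, U'.map (eval z) = U z := fun z => by
    ext i j; simp [← hFU, hUdef]
  have hUU : ∀ z ∈ unitCircle, (U z)ᴴ * U z = 1 := fun z hz => by
    have := congrArg (fun M => M.map (eval ⟨z, hz⟩)) hU
    simp only [Matrix.map_mul] at this
    rw [hUmap, Matrix.map_one _ (map_zero _) (map_one _)] at this
    rw [← this, ← hUmap ⟨z, hz⟩]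
    rfl
  have hUU' : ∀ z ∈ unitCircle, U z * (U z)ᴴ = 1 := fun z hz => mul_eq_one_comm.mp (hUU z hz)
  have hone : MatrixHolomorphicOnCircle fun _ => (1 : Matrix (Fin n) (Fin n) ℂ) :=
    fun i j => analyticOnNhd_const
  have hdiag : MatrixHolomorphicOnCircle fun z => diagonal fun i => μ i z := by
    intro i j
    rcases eq_or_ne i j with rfl | hij
    · simpa using hμ i
    · simpa [hij] using! (analyticOnNhd_const : HolomorphicOnCircle fun _ => 0)
  refine ⟨U, ⟨hUhol, ?_, ?_⟩, ?_⟩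
  · exact (hUhol.mul hUhol.paraConj).eventually_eq hone fun z hz => by
      rw [paraConj_eq_conjTranspose U hz, hUU' z hz]
  · exact (hUhol.paraConj.mul hUhol).eventually_eq hone fun z hz => by
      rw [paraConj_eq_conjTranspose U hz, hUU z hz]
  · refine hA.holomorphic.eventually_eq ((hUhol.mul hdiag).mul hUhol.paraConj) fun z hz => ?_
    have := congrArg (fun M => M.map (eval ⟨z, hz⟩)) hAU
    simp only [Matrix.map_mul] at this
    rw [hUmap, hmap, diagonal_map (map_zero _)] at this
    rw [paraConj_eq_conjTranspose U hz]
    have h2 : A z * U z = U z * diagonal fun i => μ i z := this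
    rw [← h2, Matrix.mul_assoc, hUU' z hz, Matrix.mul_one]
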